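/- Let $\mathbb{D}$ be the open unit disc and $\mathbb{T}$ the unit circle. Let $\mathcal{O}(\mathbb{D})$ be the set of analytic functions on $\mathbb{D}$, $H^\infty$ the set of bounded functions in $\mathcal{O}(\mathbb{D})$, and $H^2$ the Hardy space, whose elements are regarded both as analytic functions on $\mathbb{D}$ and as the functions in $L^2(\mathbb{T})$ with vanishing Fourier coefficients of negative index. Let $\mathscr{A}$ be the set of all polynomials $a(z)=\prod_{j=1}^{N}(z-\zeta_j)$ with $N\ge 0$ and $\zeta_1,\dots,\zeta_N\in\mathbb{T}$, not necessarily distinct (so $a=1$ if $N=0$). For $a\in\mathscr{A}$ let $T_{\overline a}f=P_+(\overline a f)$, $f\in H^2$, be the co-analytic Toeplitz operator on $H^2$, where $P_+$ is the orthogonal projection of $L^2(\mathbb{T})$ onto $H^2$, and let $\mathscr{M}(\overline a)=T_{\overline a}H^2$, considered as a set of functions on $\mathbb{D}$. For $a_1,a_2\in\mathscr{A}$ let $$\mathfrak{M}(\overline{a_1},\overline{a_2})=\{\varphi\in\mathcal{O}(\mathbb{D}) : \varphi f\in\mathscr{M}(\overline{a_2})\text{ for all } f\in\mathscr{M}(\overline{a_1})\}$$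 be the set of multipliers from $\mathscr{M}(\overline{a_1})$ to $\mathscr{M}(\overline{a_2})$. **Theorem.** Suppose that $a_1,a_2\in\mathscr{A}$ and $k:=a_2/a_1\in H^\infty$. Then $$\mathfrak{M}(\overline{a_1},\overline{a_2})=k\,\bigl(\mathscr{M}(\overline{a_1})\cap H^\infty\bigr)=\{k\psi : \psi\in\mathscr{M}(\overline{a_1})\cap H^\infty\}.$$ -/

import Mathlib

open Complex MeasureTheory Polynomial
open scoped ComplexConjugate ENNReal UnitDisc

noncomputable section

namespace ToeplitzRange

/-- `L²(𝕋)` with respect to normalized Lebesgue measure, where the circle `𝕋` is parametrized as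
`ℝ/ℤ` through `x ↦ e^{2πix}` (so that `dx = dθ/2π`). -/
abbrev L2 : Type := Lp ℂ 2 (AddCircle.haarAddCircle (T := (1 : ℝ)))

/-- `L^∞(𝕋)`. -/
abbrev Linf : Type := Lp ℂ ∞ (AddCircle.haarAddCircle (T := (1 : ℝ)))

/-- The Hardy space `H²`, as the subspace of `L²(𝕋)` of functions whose Fourier coefficients of
negative index vanish. -/
def H2 : Submodule ℂ L2 where
  carrier := {f | ∀ n : ℤ, n < 0 → fourierCoeff f n = 0}
  zero_mem' := by
    intro n _
    rw [← fourierBasis_repr]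
    simp
  add_mem' := by
    intro f g hf hg n hn
    have h1 := hf n hn
    have h2 := hg n hn
    rw [← fourierBasis_repr] at h1 h2 ⊢
    simp [h1, h2]
  smul_mem' := by
    intro c f hf n hn
    have h1 := hf n hn
    rw [← fourierBasis_repr] at h1 ⊢
    simp [h1]

theorem isClosed_H2 : IsClosed (H2 : Set L2) := by
  have h : (H2 : Set L2) = ⋂ n : ℤ, ⋂ _ : n < 0,
      {f : L2 | inner ℂ (fourierBasis (T := (1 : ℝ)) n) f = 0} := by
    ext f
    simp only [Set.mem_iInter, Set.mem_ofPred_eq, SetLike.mem_coe]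
    refine forall_congr' fun n => forall_congr' fun _ => ?_
    rw [← HilbertBasis.repr_apply_apply, fourierBasis_repr]
  rw [h]
  refine isClosed_iInter fun n => isClosed_iInter fun _ => ?_
  exact isClosed_eq (by fun_prop) continuous_const

instance : CompleteSpace H2 := isClosed_H2.completeSpace_coe

/-- The Toeplitz operator `T_u f = P₊(u f)` on `H²` with symbol `u ∈ L^∞(𝕋)`, where `P₊` is the
orthogonal projection of `L²(𝕋)` onto `H²`. -/
def toeplitz (u : Linf) (f : H2) : H2 :=
  H2.orthogonalProjectionOnto (u • (f : L2) : L2)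

/-- The function `z ↦ ∑ₙ f̂(n) zⁿ` on the open unit disc `𝔻` whose boundary function is
`f ∈ H²`. -/
def toDisc (f : H2) : 𝔻 → ℂ :=
  fun z => ∑' n : ℕ, fourierCoeff ((f : L2) : AddCircle (1 : ℝ) → ℂ) (n : ℤ) * (z : ℂ) ^ n

/-- The boundary function of `ā` for a polynomial `a`: `x ↦ conj (a (e^{2πix}))`. -/
def conjSymbol (a : ℂ[X]) : Linf :=
  ContinuousMap.toLp ∞ AddCircle.haarAddCircle ℂ
    (⟨fun x : AddCircle (1 : ℝ) => conj (a.eval (AddCircle.toCircle x : ℂ)), by fun_prop⟩ :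
      C(AddCircle (1 : ℝ), ℂ))

/-- The range space `𝓜(ā) = T_ā H²`, as a set of functions on `𝔻`. -/
def rangeSpace (a : ℂ[X]) : Set (𝔻 → ℂ) :=
  Set.range fun f : H2 => toDisc (toeplitz (conjSymbol a) f)

/-- `𝒪(𝔻)`: the analytic functions on `𝔻`. -/
def analyticFunctions : Set (𝔻 → ℂ) :=
  {f | ∃ F : ℂ → ℂ, DifferentiableOn ℂ F (Metric.ball 0 1) ∧ ∀ z : 𝔻, f z = F z}

/-- `H^∞`: the bounded analytic functions on `𝔻`. -/
def Hinf : Set (𝔻 → ℂ) :=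
  {f | f ∈ analyticFunctions ∧ ∃ C : ℝ, ∀ z : 𝔻, ‖f z‖ ≤ C}

/-- The multipliers `𝔐(ā₁, ā₂)` from `𝓜(ā₁)` to `𝓜(ā₂)`. -/
def multipliers (a₁ a₂ : ℂ[X]) : Set (𝔻 → ℂ) :=
  {φ | φ ∈ analyticFunctions ∧ ∀ f ∈ rangeSpace a₁, φ * f ∈ rangeSpace a₂}

/-- The class `𝒜` of polynomials `∏_{j=1}^N (z - ζⱼ)` with all `ζⱼ` on the unit circle (repetitions
are allowed, and `N = 0` gives the constant `1`). -/
def classA : Set ℂ[X] :=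
  {a | ∃ (N : ℕ) (ζ : Fin N → Circle), a = ∏ j, (X - C (ζ j : ℂ))}

end ToeplitzRange

end

/-!
Functions in `H²` are identified with their square-summable Taylor coefficients (`Seq2`), on which
multiplication by `z` is the shift `S`. Two facts carry the proof.

First, `𝓜(ā) = a H² + ℂ[z]` for `a` of class `𝒜` (`range_aeval_backShift`). Indeed `T_ā` is the
polynomial with conjugate coefficients evaluated at the backward shift `B`, and one can split off
one zero `ζ` at a time: `B - ζ̄` equals `-ζ̄ (z - ζ) B` up to constants and maps `ℂ[z]` onto itself.

Second, if `Φ H² ⊆ a H² + ℂ[z]` then `Φ = a b` with `b` bounded (`exists_bounded_of_mul_mem`).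
Writing `Φ h = a u + w` with `deg w < deg a`, the pair `(u, w)` is unique, hence depends
continuously on `h` by the closed graph theorem. For `h = a f` one has `w = 0`, and `a H²` is dense
(`denseRange_polyMul`), so `w = 0` always. Then `b = Φ / a` multiplies `H²` into itself, which makes
it bounded.

Since `k` is bounded, it is a polynomial of class `𝒜` (`exists_eq_mul_of_norm_le`). A multiplier `φ`
from `𝓜(ā₁)` to `𝓜(ā₂)` satisfies `φ a₁ H² ⊆ a₂ H² + ℂ[z]`, whence `φ = k ψ` with `ψ` bounded, and
`φ = φ · 1 ∈ a₂ H² + ℂ[z]` says that `k (ψ - a₁ g)` is a polynomial for some `g ∈ H²`. Since `k` has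
its zeros on the circle, `ψ - a₁ g` is a polynomial too (`exists_polySeq_of_polyMul`), that is
`ψ ∈ 𝓜(ā₁)`. The converse inclusion is a computation, given that bounded analytic functions multiply
`H²` into itself (`exists_ev_eq_mul`).
-/

noncomputable section

namespace ToeplitzRange

open Filter Topology AddCircle

/-! ### The sequence model of `H²` -/

/-- The Hardy space `H²` as the space of square-summable Taylor coefficient sequences. -/
abbrev Seq2 : Type := lp (fun _ : ℕ => ℂ) 2

theorem summable_sq (f : Seq2) : Summable fun n => ‖f n‖ ^ 2 := by
  simpa using (lp.memℓp f).summable (by simp)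

theorem memℓp_two_of_summable_sq {c : ℕ → ℂ} (h : Summable fun n => ‖c n‖ ^ 2) : Memℓp c 2 :=
  memℓp_gen (by simpa using h)

theorem norm_sq_eq_tsum (f : Seq2) : ‖f‖ ^ 2 = ∑' n, ‖f n‖ ^ 2 := by
  simpa using lp.norm_rpow_eq_tsum (p := 2) (by simp) f

theorem norm_coeff_le (f : Seq2) (n : ℕ) : ‖f n‖ ≤ ‖f‖ :=
  lp.norm_apply_le_norm (by simp) f n

/-- The underlying sequence of a shifted sequence. -/
def consZero (f : ℕ → ℂ) : ℕ → ℂ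
  | 0 => 0
  | n + 1 => f n

theorem hasSum_sq_consZero (f : Seq2) : HasSum (fun n => ‖consZero f n‖ ^ 2) (‖f‖ ^ 2) := by
  rw [← hasSum_nat_add_iff' 1]
  simpa [consZero, norm_sq_eq_tsum] using (summable_sq f).hasSum

/-- The shift on `Seq2`, which is multiplication by `z` on `H²`. -/
def shift : Seq2 →L[ℂ] Seq2 :=
  LinearMap.mkContinuous
    { toFun := fun f => ⟨consZero f, memℓp_two_of_summable_sq (hasSum_sq_consZero f).summable⟩
      map_add' := by
        intro f g
        ext n
        cases n with
        | zero => exact (add_zero (0 : ℂ)).symm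
        | succ n => rfl
      map_smul' := by
        intro c f
        ext n
        cases n <;> simp [consZero] } 1 <| by
    intro f
    rw [one_mul, ← sq_le_sq₀ (norm_nonneg _) (norm_nonneg _), norm_sq_eq_tsum]
    exact (hasSum_sq_consZero f).tsum_eq.le

@[simp] theorem shift_apply_zero (f : Seq2) : shift f 0 = 0 := rfl

@[simp] theorem shift_apply_succ (f : Seq2) (n : ℕ) : shift f (n + 1) = f n := rfl

/-- The backward shift on `Seq2`, which is `f ↦ (f - f(0)) / z` on `H²`. -/
def backShift : Seq2 →ₗ[ℂ] Seq2 where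
  toFun f := ⟨fun n => f (n + 1),
    memℓp_two_of_summable_sq ((summable_nat_add_iff 1).mpr (summable_sq f))⟩
  map_add' _ _ := rfl
  map_smul' _ _ := rfl

@[simp] theorem backShift_apply (f : Seq2) (n : ℕ) : backShift f n = f (n + 1) := rfl

theorem backShift_pow_apply (k : ℕ) (f : Seq2) (n : ℕ) : (backShift ^ k) f n = f (n + k) := by
  induction k generalizing n with
  | zero => simp
  | succ k ih => rw [pow_succ', Module.End.mul_apply, backShift_apply, ih, add_right_comm, add_assoc]

/-- The coefficient sequence of the constant function `1`. -/
def oneSeq : Seq2 := lp.single 2 0 1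

@[simp] theorem oneSeq_zero : oneSeq 0 = 1 := lp.single_apply_self ..

@[simp] theorem oneSeq_succ (n : ℕ) : oneSeq (n + 1) = 0 := lp.single_apply_ne _ _ _ (by simp)

/-- Multiplication by the polynomial `a` on `Seq2`. -/
def polyMul (a : ℂ[X]) : Seq2 →L[ℂ] Seq2 := aeval shift a

theorem polyMul_mul (a b : ℂ[X]) (f : Seq2) : polyMul (a * b) f = polyMul a (polyMul b f) := by
  simp [polyMul]

theorem polyMul_add (a b : ℂ[X]) (f : Seq2) : polyMul (a + b) f = polyMul a f + polyMul b f := by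
  simp [polyMul]

@[simp] theorem polyMul_one (f : Seq2) : polyMul 1 f = f := by simp [polyMul]

theorem polyMul_C (c : ℂ) (f : Seq2) : polyMul (C c) f = c • f := by
  simp [polyMul, Algebra.algebraMap_eq_smul_one]

theorem polyMul_X (f : Seq2) : polyMul X f = shift f := by simp [polyMul]

theorem polyMul_X_sub_C (ζ : ℂ) (f : Seq2) : polyMul (X - C ζ) f = shift f - ζ • f := by
  simp [polyMul, Algebra.algebraMap_eq_smul_one]

/-- The coefficient sequence of a polynomial. -/
def polySeq : ℂ[X] →ₗ[ℂ] Seq2 :=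
  LinearMap.applyₗ oneSeq ∘ₗ (ContinuousLinearMap.coeLM ℂ) ∘ₗ (aeval shift).toLinearMap

theorem polySeq_eq (p : ℂ[X]) : polySeq p = polyMul p oneSeq := rfl

theorem polyMul_polySeq (a p : ℂ[X]) : polyMul a (polySeq p) = polySeq (a * p) := by
  simp only [polySeq_eq, polyMul_mul]

@[simp] theorem polySeq_apply (p : ℂ[X]) (n : ℕ) : polySeq p n = p.coeff n := by
  induction p using Polynomial.induction_on generalizing n with
  | C c =>
    rw [polySeq_eq, polyMul_C]
    cases n <;> simp [coeff_C]
  | add p q hp hq => simp [hp, hq]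
  | monomial k c ih =>
    rw [show C c * X ^ (k + 1) = X * (C c * X ^ k) by ring, ← polyMul_polySeq, polyMul_X]
    cases n with
    | zero => simp
    | succ n => rw [shift_apply_succ, ih, coeff_X_mul]

/-! ### Evaluation on the disc -/

theorem summable_coeff_mul_pow (f : Seq2) (z : 𝔻) : Summable fun n => ‖f n * (z : ℂ) ^ n‖ := by
  refine Summable.of_nonneg_of_le (fun _ => norm_nonneg _) (fun n => ?_)
    ((summable_geometric_of_lt_one (norm_nonneg (z : ℂ)) z.norm_lt_one).mul_left ‖f‖)
  rw [norm_mul, norm_pow]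
  gcongr
  exact norm_coeff_le f n

/-- The function on the disc with the given square-summable Taylor coefficients. -/
def ev : Seq2 →ₗ[ℂ] (𝔻 → ℂ) where
  toFun f z := ∑' n, f n * (z : ℂ) ^ n
  map_add' f g := by
    ext z
    simp only [lp.coeFn_add, Pi.add_apply, add_mul]
    exact (summable_coeff_mul_pow f z).of_norm.tsum_add (summable_coeff_mul_pow g z).of_norm
  map_smul' c f := by
    ext z
    simp [mul_assoc, tsum_mul_left]

theorem ev_apply (f : Seq2) (z : 𝔻) : ev f z = ∑' n, f n * (z : ℂ) ^ n := rfl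

/-- Point evaluations are bounded on `H²`. -/
theorem norm_ev_le (f : Seq2) (z : 𝔻) : ‖ev f z‖ ≤ (1 - ‖(z : ℂ)‖)⁻¹ * ‖f‖ := by
  refine (norm_tsum_le_tsum_norm (summable_coeff_mul_pow f z)).trans ?_
  rw [mul_comm, ← tsum_geometric_of_lt_one (norm_nonneg (z : ℂ)) z.norm_lt_one, ← tsum_mul_left]
  refine (summable_coeff_mul_pow f z).tsum_le_tsum (fun n => ?_)
    ((summable_geometric_of_lt_one (norm_nonneg (z : ℂ)) z.norm_lt_one).mul_left ‖f‖)
  rw [norm_mul, norm_pow]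
  gcongr
  exact norm_coeff_le f n

theorem continuous_ev_apply (z : 𝔻) : Continuous fun f : Seq2 => ev f z :=
  ((LinearMap.proj z ∘ₗ ev).mkContinuous _ fun f => norm_ev_le f z).continuous

theorem ev_shift (f : Seq2) (z : 𝔻) : ev (shift f) z = z * ev f z := by
  rw [ev_apply, (summable_coeff_mul_pow (shift f) z).of_norm.tsum_eq_zero_add, ev_apply,
    ← tsum_mul_left]
  simp only [shift_apply_zero, shift_apply_succ, zero_mul, zero_add]
  exact tsum_congr fun n => by ring

theorem ev_oneSeq (z : 𝔻) : ev oneSeq z = 1 := by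
  rw [ev_apply, tsum_eq_single 0]
  · simp
  · intro n hn
    obtain ⟨m, rfl⟩ := Nat.exists_eq_succ_of_ne_zero hn
    simp

theorem ev_polyMul (a : ℂ[X]) (f : Seq2) (z : 𝔻) : ev (polyMul a f) z = a.eval (z : ℂ) * ev f z := by
  induction a using Polynomial.induction_on with
  | C c => simp [polyMul_C]
  | add p q hp hq => simp [polyMul_add, hp, hq, add_mul]
  | monomial n c h =>
    rw [show C c * X ^ (n + 1) = X * (C c * X ^ n) by ring, polyMul_mul, polyMul_X, ev_shift, h,
      eval_mul (p := X), eval_X, mul_assoc]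

theorem ev_polySeq (p : ℂ[X]) (z : 𝔻) : ev (polySeq p) z = p.eval (z : ℂ) := by
  rw [polySeq_eq, ev_polyMul, ev_oneSeq, mul_one]

/-- A power series with square-summable, hence bounded, coefficients converges to an analytic function on the disc. -/
theorem hasFPowerSeriesOnBall_ofScalars (f : Seq2) :
    HasFPowerSeriesOnBall (fun z : ℂ => ∑' n, f n * z ^ n)
      (FormalMultilinearSeries.ofScalars ℂ (f : ℕ → ℂ)) 0 1 := by
  have hr : (1 : ℝ≥0∞) ≤ (FormalMultilinearSeries.ofScalars ℂ (f : ℕ → ℂ)).radius := by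
    refine FormalMultilinearSeries.le_radius_of_bound (r := 1) _ ‖f‖ fun n => ?_
    simpa [FormalMultilinearSeries.ofScalars_norm] using norm_coeff_le f n
  have h := (FormalMultilinearSeries.hasFPowerSeriesOnBall _ (one_pos.trans_le hr)).mono one_pos hr
  convert h using 1
  ext z
  simp [FormalMultilinearSeries.sum, mul_comm]

theorem ev_injective : Function.Injective ev := by
  intro f g hfg
  have hf := (hasFPowerSeriesOnBall_ofScalars f).hasFPowerSeriesAt
  have hg := (hasFPowerSeriesOnBall_ofScalars g).hasFPowerSeriesAt
  have h : (fun z : ℂ => ∑' n, f n * z ^ n) =ᶠ[𝓝 0] fun z : ℂ => ∑' n, g n * z ^ n := by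
    filter_upwards [Metric.ball_mem_nhds (0 : ℂ) one_pos] with z hz
    exact congrFun hfg (UnitDisc.mk z (by simpa using hz))
  have h2 := hf.eq_formalMultilinearSeries (hg.congr h.symm)
  exact lp.ext (FormalMultilinearSeries.ofScalars_series_injective ℂ ℂ h2)

theorem ev_mem_analyticFunctions (f : Seq2) : ev f ∈ analyticFunctions := by
  refine ⟨fun z => ∑' n, f n * z ^ n, ?_, fun z => rfl⟩
  have h := (hasFPowerSeriesOnBall_ofScalars f).differentiableOn
  rwa [show Metric.eball (0 : ℂ) 1 = Metric.ball 0 1 from by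
    simpa using Metric.eball_ofReal (x := (0 : ℂ)) (ε := 1)] at h

/-! ### Boundary functions and Fourier coefficients -/

theorem summable_sq_extend (c : Seq2) :
    Summable fun i : ℤ => ‖Function.extend ((↑) : ℕ → ℤ) (c : ℕ → ℂ) 0 i‖ ^ 2 := by
  rw [← Function.Injective.summable_iff (g := ((↑) : ℕ → ℤ)) Nat.cast_injective]
  · convert summable_sq c using 2 with n
    simp [Function.comp_apply, Nat.cast_injective.extend_apply]
  · intro i hi
    simp [Function.extend_apply' _ _ _ hi]

/-- The Fourier coefficients of nonnegative index of `f ∈ H²`. -/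
def toSeq (f : H2) : Seq2 :=
  ⟨fun n => fourierCoeff ((f : L2) : AddCircle (1 : ℝ) → ℂ) (n : ℤ),
    memℓp_two_of_summable_sq
      ((hasSum_sq_fourierCoeff (f : L2)).summable.comp_injective Nat.cast_injective)⟩

theorem toSeq_apply (f : H2) (n : ℕ) :
    toSeq f n = fourierCoeff ((f : L2) : AddCircle (1 : ℝ) → ℂ) (n : ℤ) := rfl

theorem toDisc_eq_ev_toSeq (f : H2) : toDisc f = ev (toSeq f) := rfl

/-- Every square-summable sequence on `ℕ`, extended by zero to `ℤ`, comes from some `f ∈ H²`. -/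
theorem toSeq_surjective : Function.Surjective toSeq := by
  intro c
  let g : lp (fun _ : ℤ => ℂ) 2 :=
    ⟨Function.extend ((↑) : ℕ → ℤ) (c : ℕ → ℂ) 0, memℓp_gen (by simpa using summable_sq_extend c)⟩
  have hg : ∀ i : ℤ, fourierCoeff (fourierBasis.repr.symm g : L2) i =
      Function.extend ((↑) : ℕ → ℤ) (c : ℕ → ℂ) 0 i := by
    intro i
    rw [← fourierBasis_repr, LinearIsometryEquiv.apply_symm_apply]
  refine ⟨⟨fourierBasis.repr.symm g, fun n hn => ?_⟩, ?_⟩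
  · rw [hg, Function.extend_apply' _ _ _ (by rintro ⟨m, rfl⟩; omega)]
    rfl
  · ext n
    rw [toSeq_apply, hg, Nat.cast_injective.extend_apply]

theorem fourierBasis_mem_H2 (n : ℕ) : fourierBasis (T := (1 : ℝ)) (n : ℤ) ∈ H2 := by
  intro m hm
  rw [← fourierBasis_repr, HilbertBasis.repr_self, lp.single_apply_ne]
  omega

/-- Compressing by `P₊` does not change the Fourier coefficients of nonnegative index. -/
theorem fourierCoeff_toeplitz (u : Linf) (f : H2) (n : ℕ) :
    fourierCoeff ((toeplitz u f : L2) : AddCircle (1 : ℝ) → ℂ) (n : ℤ) =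
      fourierCoeff ((u • (f : L2) : L2) : AddCircle (1 : ℝ) → ℂ) (n : ℤ) := by
  rw [← fourierBasis_repr, ← fourierBasis_repr, HilbertBasis.repr_apply_apply,
    HilbertBasis.repr_apply_apply]
  exact Submodule.inner_orthogonalProjectionOnto_eq_of_mem_left
    (⟨_, fourierBasis_mem_H2 n⟩ : H2) (u • (f : L2) : L2)

theorem fourierCoeff_fourier_neg_smul (f : AddCircle (1 : ℝ) → ℂ) (m n : ℤ) :
    fourierCoeff (fun t => fourier (-m) t • f t) n = fourierCoeff f (n + m) := by
  simp only [fourierCoeff]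
  refine integral_congr_ae (Filter.Eventually.of_forall fun t => ?_)
  simp only [smul_smul, ← fourier_add]
  congr 3
  ring

theorem fourierCoeff_conjSymbol_smul (a : ℂ[X]) (f : L2) (n : ℤ) :
    fourierCoeff ((conjSymbol a • f : L2) : AddCircle (1 : ℝ) → ℂ) n =
      ∑ j ∈ Finset.range (a.natDegree + 1), conj (a.coeff j) * fourierCoeff f (n + j) := by
  have hf : Integrable f haarAddCircle := (Lp.memLp f).integrable (by norm_num)
  have h : ((conjSymbol a • f : L2) : AddCircle (1 : ℝ) → ℂ) =ᵐ[haarAddCircle]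
      ∑ j ∈ Finset.range (a.natDegree + 1),
        (conj (a.coeff j) • fun t => fourier (-(j : ℤ)) t • f t : AddCircle (1 : ℝ) → ℂ) := by
    filter_upwards [Lp.coeFn_lpSMul (r := 2) (conjSymbol a) f,
      ContinuousMap.coeFn_toLp (p := ∞) (𝕜 := ℂ) haarAddCircle
        (⟨fun x : AddCircle (1 : ℝ) => conj (a.eval (AddCircle.toCircle x : ℂ)), by fun_prop⟩ :
          C(AddCircle (1 : ℝ), ℂ))] with t h1 h2
    rw [h1, Pi.smul_apply', conjSymbol, h2, Finset.sum_apply]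
    simp only [ContinuousMap.coe_mk, eval_eq_sum_range, map_sum, map_mul, map_pow, smul_eq_mul,
      Finset.sum_mul, Pi.smul_apply]
    refine Finset.sum_congr rfl fun j _ => ?_
    rw [fourier_neg, fourier_apply, toCircle_zsmul]
    simp [mul_assoc]
  rw [fourierCoeff_congr_ae h, fourierCoeff.sum, Finset.sum_apply]
  · refine Finset.sum_congr rfl fun j _ => ?_
    rw [fourierCoeff.const_smul, fourierCoeff_fourier_neg_smul, smul_eq_mul]
  · intro j _
    exact (hf.fourier_smul _).smul _

/-- On coefficient sequences, `T_ā` is the conjugate polynomial evaluated at the backward shift. -/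
theorem toSeq_toeplitz_conjSymbol (a : ℂ[X]) (f : H2) :
    toSeq (toeplitz (conjSymbol a) f) =
      aeval backShift (a.map (starRingEnd ℂ)) (toSeq f) := by
  ext n
  rw [toSeq_apply, fourierCoeff_toeplitz, fourierCoeff_conjSymbol_smul, aeval_eq_sum_range,
    natDegree_map, LinearMap.sum_apply, lp.coeFn_sum, Finset.sum_apply]
  refine Finset.sum_congr rfl fun j _ => ?_
  rw [LinearMap.smul_apply, lp.coeFn_smul, Pi.smul_apply, backShift_pow_apply, coeff_map,
    toSeq_apply, smul_eq_mul, Nat.cast_add]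

theorem mem_rangeSpace_iff (a : ℂ[X]) (g : 𝔻 → ℂ) :
    g ∈ rangeSpace a ↔ ∃ f : Seq2, g = ev (aeval backShift (a.map (starRingEnd ℂ)) f) := by
  constructor
  · rintro ⟨f, rfl⟩
    exact ⟨toSeq f, by simp only [toDisc_eq_ev_toSeq, toSeq_toeplitz_conjSymbol]⟩
  · rintro ⟨f, rfl⟩
    obtain ⟨f, rfl⟩ := toSeq_surjective f
    exact ⟨f, by simp only [toDisc_eq_ev_toSeq, toSeq_toeplitz_conjSymbol]⟩

/-! ### Parseval's identity and products with bounded functions -/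

/-- Parseval's identity for an absolutely convergent power series on the unit circle. -/
theorem tsum_sq_eq_integral {c : ℕ → ℂ} (hc : Summable fun n => ‖c n‖) :
    ∑' n, ‖c n‖ ^ 2 =
      ∫ t : AddCircle (1 : ℝ), ‖∑' n, c n * (toCircle t : ℂ) ^ n‖ ^ 2 ∂haarAddCircle := by
  have hs : Summable fun n : ℕ => c n • (fourier (n : ℤ) : C(AddCircle (1 : ℝ), ℂ)) := by
    refine Summable.of_norm ?_
    simpa [norm_smul, fourier_norm] using hc
  set G : C(AddCircle (1 : ℝ), ℂ) := ∑' n : ℕ, c n • fourier (n : ℤ) with hG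
  have hGt : ∀ t, G t = ∑' n, c n * (toCircle t : ℂ) ^ n := by
    intro t
    rw [hG, ← ContinuousMap.tsum_apply hs]
    refine tsum_congr fun n => ?_
    rw [ContinuousMap.smul_apply, fourier_apply, toCircle_zsmul]
    simp
  set g : L2 := ContinuousMap.toLp (E := ℂ) 2 haarAddCircle ℂ G with hg
  have hsum : HasSum (fun n : ℕ => c n • fourierBasis (T := (1 : ℝ)) (n : ℤ)) g := by
    have := (ContinuousMap.toLp (E := ℂ) 2 haarAddCircle ℂ).hasSum hs.hasSum
    simpa only [map_smul, coe_fourierBasis, ← hG, ← hg] using this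
  have hcoef : ∀ i : ℤ, HasSum (fun n : ℕ => c n * (if (n : ℤ) = i then 1 else 0))
      (fourierCoeff g i) := by
    intro i
    rw [← fourierBasis_repr, HilbertBasis.repr_apply_apply]
    have e : (fun n : ℕ => c n * (if (n : ℤ) = i then 1 else 0)) = fun n : ℕ =>
        innerSL ℂ (fourierBasis (T := (1 : ℝ)) i) (c n • fourierBasis (T := (1 : ℝ)) (n : ℤ)) := by
      funext n
      rw [innerSL_apply_apply, inner_smul_right, orthonormal_iff_ite.mp fourierBasis.orthonormal]
      simp only [eq_comm]
    rw [e]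
    exact (innerSL ℂ (fourierBasis (T := (1 : ℝ)) i)).hasSum hsum
  have hnat : ∀ n : ℕ, fourierCoeff g (n : ℤ) = c n := by
    intro n
    refine (hcoef n).unique ?_
    convert hasSum_ite_eq n (c n) using 2 with m
    split_ifs <;> simp_all
  have hneg : ∀ i : ℤ, i ∉ Set.range ((↑) : ℕ → ℤ) → fourierCoeff g i = 0 := by
    intro i hi
    refine (hcoef i).unique ?_
    convert hasSum_zero using 2 with m
    rw [if_neg (fun h => hi ⟨m, h⟩), mul_zero]
  have hP := tsum_sq_fourierCoeff g
  rw [← Function.Injective.tsum_eq (g := ((↑) : ℕ → ℤ)) Nat.cast_injective] at hP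
  · simp only [hnat] at hP
    rw [hP]
    refine integral_congr_ae ?_
    filter_upwards [ContinuousMap.coeFn_toLp (p := 2) (𝕜 := ℂ) haarAddCircle G] with t ht
    rw [hg, ht, hGt]
  · intro i hi
    by_contra h
    exact hi (by simp [hneg i h])

/-- If `b` is analytic and bounded on the disc and `f ∈ H²`, then `b f ∈ H²`. -/
theorem exists_ev_eq_mul {b : 𝔻 → ℂ} (hb : b ∈ Hinf) (f : Seq2) : ∃ g : Seq2, ev g = b * ev f := by
  obtain ⟨hba, C, hC⟩ := hb
  obtain ⟨F, hF, hFb⟩ := hba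
  obtain ⟨G, hG, hGf⟩ := ev_mem_analyticFunctions f
  set c : ℕ → ℂ := fun n => (n.factorial : ℂ)⁻¹ * iteratedDeriv n (F * G) 0 with hc
  have hsum : ∀ z : 𝔻, HasSum (fun n => c n * (z : ℂ) ^ n) (b z * ev f z) := by
    intro z
    have := Complex.hasSum_taylorSeries_on_ball (hF.mul hG)
      (show (z : ℂ) ∈ Metric.ball 0 1 by simpa using z.norm_lt_one)
    rw [hFb, hGf]
    have e : (fun n => c n * (z : ℂ) ^ n) = fun n =>
        (n.factorial : ℂ)⁻¹ • ((z : ℂ) - 0) ^ n • iteratedDeriv n (F * G) 0 := by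
      funext n
      simp only [hc, sub_zero, smul_eq_mul]
      ring
    rw [e]
    exact this
  have habs : ∀ r : ℝ, 0 ≤ r → r < 1 → Summable fun n => ‖c n * (r : ℂ) ^ n‖ := by
    intro r hr0 hr1
    exact (hsum (UnitDisc.mk r (by simpa [abs_of_nonneg hr0] using hr1))).summable.norm
  have hr : ∀ r : ℝ, 0 ≤ r → r < 1 → ∀ s : Finset ℕ,
      ∑ n ∈ s, ‖c n * (r : ℂ) ^ n‖ ^ 2 ≤ C ^ 2 * ‖f‖ ^ 2 := by
    intro r hr0 hr1 s
    have key : ∀ t : AddCircle (1 : ℝ), ‖(r : ℂ) * (toCircle t : ℂ)‖ < 1 := by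
      intro t
      simpa [abs_of_nonneg hr0, Circle.norm_coe] using hr1
    have hf2 : Summable fun n => ‖f n * (r : ℂ) ^ n‖ :=
      summable_coeff_mul_pow f (UnitDisc.mk r (by simpa [abs_of_nonneg hr0] using hr1))
    have hsq : ∀ d : ℕ → ℂ, Summable (fun n => ‖d n‖) → Summable fun n => ‖d n‖ ^ 2 := by
      intro d hd
      refine hd.of_norm_bounded_eventually_nat ?_
      filter_upwards [hd.tendsto_atTop_zero.eventually_le_const one_pos] with n hn
      rw [Real.norm_of_nonneg (by positivity)]
      nlinarith [norm_nonneg (d n)]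
    have hval : ∀ (d : ℕ → ℂ) (t : AddCircle (1 : ℝ)),
        ∑' n, d n * (r : ℂ) ^ n * (toCircle t : ℂ) ^ n =
          ∑' n, d n * ((UnitDisc.mk _ (key t) : 𝔻) : ℂ) ^ n := by
      intro d t
      refine tsum_congr fun n => ?_
      rw [UnitDisc.coe_mk, mul_pow, mul_assoc]
    have hcont : ∀ d : ℕ → ℂ, Summable (fun n => ‖d n‖) →
        Continuous fun t : AddCircle (1 : ℝ) => ‖∑' n, d n * (toCircle t : ℂ) ^ n‖ ^ 2 := by
      intro d hd
      refine ((continuous_tsum (fun n => by fun_prop) hd fun n t => ?_).norm).pow 2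
      simp [Circle.norm_coe]
    calc ∑ n ∈ s, ‖c n * (r : ℂ) ^ n‖ ^ 2
        ≤ ∑' n, ‖c n * (r : ℂ) ^ n‖ ^ 2 :=
          (hsq _ (habs r hr0 hr1)).sum_le_tsum s fun _ _ => by positivity
      _ = ∫ t : AddCircle (1 : ℝ),
            ‖∑' n, c n * (r : ℂ) ^ n * (toCircle t : ℂ) ^ n‖ ^ 2 ∂haarAddCircle :=
          tsum_sq_eq_integral (habs r hr0 hr1)
      _ ≤ ∫ t : AddCircle (1 : ℝ),
            C ^ 2 * ‖∑' n, f n * (r : ℂ) ^ n * (toCircle t : ℂ) ^ n‖ ^ 2 ∂haarAddCircle := by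
          refine integral_mono
            ((hcont _ (habs r hr0 hr1)).integrable_of_hasCompactSupport
              (HasCompactSupport.of_compactSpace _))
            (((hcont _ hf2).const_mul _).integrable_of_hasCompactSupport
              (HasCompactSupport.of_compactSpace _)) fun t => ?_
          simp only [hval]
          rw [(hsum _).tsum_eq, ← ev_apply, norm_mul, mul_pow]
          gcongr
          exact hC _
      _ = C ^ 2 * ∑' n, ‖f n * (r : ℂ) ^ n‖ ^ 2 := by
          rw [integral_const_mul, tsum_sq_eq_integral hf2]
      _ ≤ C ^ 2 * ‖f‖ ^ 2 := by
          rw [norm_sq_eq_tsum]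
          gcongr with n
          · exact hsq _ hf2
          · exact summable_sq f
          · rw [norm_mul, norm_pow, norm_real, Real.norm_of_nonneg hr0]
            exact mul_le_of_le_one_right (norm_nonneg _) (pow_le_one₀ hr0 hr1.le)
  have hone : ∀ s : Finset ℕ, ∑ n ∈ s, ‖c n‖ ^ 2 ≤ C ^ 2 * ‖f‖ ^ 2 := by
    intro s
    have hcts : Filter.Tendsto (fun r : ℝ => ∑ n ∈ s, ‖c n * (r : ℂ) ^ n‖ ^ 2)
        (nhdsWithin 1 (Set.Iio 1)) (nhds (∑ n ∈ s, ‖c n‖ ^ 2)) := by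
      have : Continuous fun r : ℝ => ∑ n ∈ s, ‖c n * (r : ℂ) ^ n‖ ^ 2 := by fun_prop
      simpa using (this.tendsto 1).mono_left nhdsWithin_le_nhds
    refine le_of_tendsto hcts ?_
    filter_upwards [Ioo_mem_nhdsLT (zero_lt_one' ℝ)] with r hr'
    exact hr r hr'.1.le hr'.2 s
  refine ⟨⟨c, memℓp_two_of_summable_sq
    (summable_of_sum_le (fun _ => by positivity) hone)⟩, ?_⟩
  ext z
  exact (hsum z).tsum_eq

/-! ### The class `𝒜` -/

theorem one_mem_classA : (1 : ℂ[X]) ∈ classA := ⟨0, Fin.elim0, by simp⟩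

theorem X_sub_C_mul_mem_classA (ζ : Circle) {b : ℂ[X]} (hb : b ∈ classA) :
    (X - C (ζ : ℂ)) * b ∈ classA := by
  obtain ⟨N, η, rfl⟩ := hb
  exact ⟨N + 1, Fin.cons ζ η, by simp [Fin.prod_univ_succ]⟩

/-- Induction on the number of zeros of a polynomial of class `𝒜`. -/
@[elab_as_elim]
theorem classA_induction {P : ∀ a : ℂ[X], a ∈ classA → Prop} (one : P 1 one_mem_classA)
    (mul : ∀ (ζ : Circle) (b : ℂ[X]) (hb : b ∈ classA), P b hb →
      P ((X - C (ζ : ℂ)) * b) (X_sub_C_mul_mem_classA ζ hb))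
    {a : ℂ[X]} (ha : a ∈ classA) : P a ha := by
  have aux : ∀ (N : ℕ) (ζ : Fin N → Circle),
      ∃ h : (∏ j, (X - C (ζ j : ℂ)) : ℂ[X]) ∈ classA, P _ h := by
    intro N
    induction N with
    | zero => exact fun ζ => ⟨⟨0, ζ, rfl⟩, by simpa using one⟩
    | succ N ih =>
      intro ζ
      obtain ⟨h, hP⟩ := ih (fun j => ζ j.succ)
      rw [Fin.prod_univ_succ]
      exact ⟨_, mul (ζ 0) _ h hP⟩
  obtain ⟨N, ζ, rfl⟩ := ha
  exact (aux N ζ).2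

theorem monic_of_mem_classA {a : ℂ[X]} (ha : a ∈ classA) : a.Monic := by
  obtain ⟨N, ζ, rfl⟩ := ha
  exact monic_prod_of_monic _ _ fun j _ => monic_X_sub_C _

theorem eval_ne_zero_of_mem_classA {a : ℂ[X]} (ha : a ∈ classA) (z : 𝔻) : a.eval (z : ℂ) ≠ 0 := by
  induction ha using classA_induction with
  | one => simp
  | mul ζ b _ hb =>
    rw [eval_mul, eval_sub, eval_X, eval_C]
    refine mul_ne_zero (sub_ne_zero.mpr fun h => z.norm_ne_one ?_) hb
    rw [h, Circle.norm_coe]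

theorem exists_eq_X_sub_C_mul {a : ℂ[X]} (ha : a ∈ classA) {w : ℂ} (hw : a.eval w = 0) :
    ∃ b ∈ classA, a = (X - C w) * b := by
  induction ha using classA_induction with
  | one => simp at hw
  | mul ζ b hb ih =>
    rw [eval_mul, mul_eq_zero] at hw
    rcases hw with h | h
    · rw [eval_sub, eval_X, eval_C, sub_eq_zero] at h
      exact ⟨b, hb, by rw [h]⟩
    · obtain ⟨c, hc, rfl⟩ := ih h
      exact ⟨_, X_sub_C_mul_mem_classA ζ hc, by ring⟩

/-- A bounded quotient of two polynomials of class `𝒜` is a polynomial of class `𝒜`. -/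
theorem exists_eq_mul_of_norm_le {a₁ a₂ : ℂ[X]} (ha₁ : a₁ ∈ classA) (ha₂ : a₂ ∈ classA) {M : ℝ}
    (h : ∀ z : 𝔻, ‖a₂.eval (z : ℂ)‖ ≤ M * ‖a₁.eval (z : ℂ)‖) :
    ∃ K ∈ classA, a₂ = a₁ * K := by
  induction ha₁ using classA_induction generalizing a₂ with
  | one => exact ⟨a₂, ha₂, by simp⟩
  | mul ζ b _ ih =>
    have hcl : ∀ w ∈ closure (Metric.ball (0 : ℂ) 1),
        ‖a₂.eval w‖ ≤ M * ‖((X - C (ζ : ℂ)) * b).eval w‖ := by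
      refine closure_minimal (fun w hw => ?_) (isClosed_le a₂.continuous.norm
        (continuous_const.mul (Polynomial.continuous _).norm))
      exact h (UnitDisc.mk w (by simpa using hw))
    have h0 : a₂.eval (ζ : ℂ) = 0 := by
      have := hcl ζ (by simp [closure_ball (0 : ℂ) one_ne_zero, Circle.norm_coe])
      simpa using this
    obtain ⟨c, hc, rfl⟩ := exists_eq_X_sub_C_mul ha₂ h0
    have hcb : ∀ z : 𝔻, ‖c.eval (z : ℂ)‖ ≤ M * ‖b.eval (z : ℂ)‖ := by
      intro z
      have hz := h z
      have hne : 0 < ‖(X - C (ζ : ℂ)).eval (z : ℂ)‖ :=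
        norm_pos_iff.mpr (by
          simpa only [mul_one] using
            eval_ne_zero_of_mem_classA (X_sub_C_mul_mem_classA ζ one_mem_classA) z)
      rw [eval_mul, eval_mul, norm_mul, norm_mul, mul_left_comm] at hz
      exact le_of_mul_le_mul_left hz hne
    obtain ⟨K, hK, rfl⟩ := ih hc hcb
    exact ⟨K, hK, by ring⟩

/-! ### The range of `T_ā` -/

/-- The sequence form of `a H² + ℂ[z]`. -/
def polyRange (a : ℂ[X]) : Set Seq2 :=
  {g | ∃ (h : Seq2) (p : ℂ[X]), g = polyMul a h + polySeq p}

theorem shift_backShift (f : Seq2) : shift (backShift f) = f - f 0 • oneSeq := by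
  ext n
  rw [lp.coeFn_sub, lp.coeFn_smul, Pi.sub_apply, Pi.smul_apply]
  cases n <;> simp

theorem backShift_shift (f : Seq2) : backShift (shift f) = f := by
  ext n
  simp

theorem backShift_polyMul (a : ℂ[X]) (f : Seq2) :
    ∃ p : ℂ[X], backShift (polyMul a f) = polyMul a (backShift f) + polySeq p := by
  induction a using Polynomial.induction_on with
  | C c => exact ⟨0, by simp [polyMul_C]⟩
  | add p q hp hq =>
    obtain ⟨r, hr⟩ := hp
    obtain ⟨s, hs⟩ := hq
    exact ⟨r + s, by simp only [polyMul_add, map_add, hr, hs]; abel⟩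
  | monomial n c _ =>
    -- `B z m f = m f = z m B f + f(0) m` for the monomial `m = c zⁿ`.
    refine ⟨f 0 • (C c * X ^ n), ?_⟩
    rw [show C c * X ^ (n + 1) = X * (C c * X ^ n) by ring, polyMul_mul, polyMul_X,
      backShift_shift, mul_comm X, polyMul_mul (C c * X ^ n) X, polyMul_X,
      shift_backShift, map_smul, polySeq_eq, map_sub, map_smul]
    abel

theorem conj_mul_circle (ζ : Circle) : conj (ζ : ℂ) * ζ = 1 := by
  rw [← Complex.normSq_eq_conj_mul_self, Circle.normSq_coe, ofReal_one]

/-- `B - ζ̄` equals `-ζ̄ (z - ζ) B` up to constants. -/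
theorem backShift_sub_smul (ζ : Circle) (f : Seq2) :
    backShift f - conj (ζ : ℂ) • f =
      polyMul (X - C (ζ : ℂ)) (-conj (ζ : ℂ) • backShift f) +
        polySeq (C (-conj (ζ : ℂ) * f 0)) := by
  rw [polyMul_X_sub_C, map_smul, shift_backShift, polySeq_eq, polyMul_C, smul_smul, mul_neg,
    mul_comm, conj_mul_circle]
  module

theorem backShift_polySeq (p : ℂ[X]) : backShift (polySeq p) = polySeq p.divX := by
  ext n
  simp [coeff_divX]

/-- `B - ζ̄` maps the polynomials onto themselves: it sends `zⁿ⁺¹` to `zⁿ - ζ̄ zⁿ⁺¹` and `1` to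
`-ζ̄`, so preimages are found by induction on the degree. -/
theorem exists_backShift_sub_smul_eq_polySeq (ζ : Circle) (p : ℂ[X]) :
    ∃ q : ℂ[X], backShift (polySeq q) - conj (ζ : ℂ) • polySeq q = polySeq p := by
  induction p using Polynomial.induction_on with
  | C c =>
    refine ⟨C (-ζ * c), ?_⟩
    rw [backShift_polySeq, divX_C, map_zero, polySeq_eq, polySeq_eq, polyMul_C, polyMul_C,
      smul_smul, ← mul_assoc, mul_neg, conj_mul_circle]
    module
  | add p q hp hq =>
    obtain ⟨r, hr⟩ := hp
    obtain ⟨s, hs⟩ := hq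
    exact ⟨r + s, by rw [map_add, map_add, map_add, ← hr, ← hs]; module⟩
  | monomial n c ih =>
    obtain ⟨q, hq⟩ := ih
    have hd : backShift (polySeq (C c * X ^ (n + 1))) = polySeq (C c * X ^ n) := by
      rw [backShift_polySeq]
      congr 1
      ext m
      simp [coeff_divX]
    refine ⟨(ζ : ℂ) • (q - C c * X ^ (n + 1)), ?_⟩
    rw [map_smul, map_sub, map_smul, map_sub, hd, ← hq, smul_smul, conj_mul_circle]
    have := congrArg (fun v : Seq2 => (ζ : ℂ) • v) hq
    simp only [smul_sub, smul_smul, mul_comm (ζ : ℂ) (conj (ζ : ℂ)), conj_mul_circle, one_smul]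
      at this ⊢
    abel

/-- `T_ā H² = a H² + ℂ[z]` for `a` of class `𝒜`. -/
theorem range_aeval_backShift {a : ℂ[X]} (ha : a ∈ classA) :
    Set.range (aeval backShift (a.map (starRingEnd ℂ))) = polyRange a := by
  induction ha using classA_induction with
  | one =>
    ext g
    simp only [Polynomial.map_one, map_one, Set.mem_range, Module.End.one_apply, exists_eq, polyRange,
      polyMul_one, Set.mem_ofPred_eq, true_iff]
    exact ⟨g, 0, by simp⟩
  | mul ζ b hb ih =>
    have hstep : ∀ f, aeval backShift (((X - C (ζ : ℂ)) * b).map (starRingEnd ℂ)) f =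
        backShift (aeval backShift (b.map (starRingEnd ℂ)) f) -
          conj (ζ : ℂ) • aeval backShift (b.map (starRingEnd ℂ)) f := by
      intro f
      simp [Module.End.mul_apply, Algebra.algebraMap_eq_smul_one]
    ext g
    constructor
    · rintro ⟨f, rfl⟩
      obtain ⟨h, p, hp⟩ : aeval backShift (b.map (starRingEnd ℂ)) f ∈ polyRange b :=
        ih ▸ ⟨f, rfl⟩
      obtain ⟨r, hr⟩ := backShift_polyMul b h
      refine ⟨-conj (ζ : ℂ) • backShift h,
        b * C (-conj (ζ : ℂ) * h 0) + r + p.divX - conj (ζ : ℂ) • p, ?_⟩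
      have key := congrArg (polyMul b) (backShift_sub_smul ζ h)
      rw [map_sub, map_smul, map_add, ← polyMul_mul, polyMul_polySeq, mul_comm b (X - _)] at key
      rw [hstep, hp, map_add, hr, backShift_polySeq, map_sub polySeq, map_add polySeq,
        map_add polySeq, map_smul polySeq]
      calc polyMul b (backShift h) + polySeq r + polySeq p.divX -
            conj (ζ : ℂ) • (polyMul b h + polySeq p)
          = (polyMul b (backShift h) - conj (ζ : ℂ) • polyMul b h) +
            (polySeq r + polySeq p.divX - conj (ζ : ℂ) • polySeq p) := by module
        _ = _ := by rw [key]; module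
    · rintro ⟨h, p, rfl⟩
      obtain ⟨q, hq⟩ := exists_backShift_sub_smul_eq_polySeq ζ p
      -- `(B - ζ̄) (b z (-ζ h)) = b (z - ζ) h`
      have hmem : polyMul b (shift (-(ζ : ℂ) • h)) + polySeq q ∈ polyRange b := ⟨_, _, rfl⟩
      rw [← ih] at hmem
      obtain ⟨f, hf⟩ := hmem
      refine ⟨f, ?_⟩
      have hB : backShift (polyMul b (shift (-(ζ : ℂ) • h))) = polyMul b (-(ζ : ℂ) • h) := by
        rw [← polyMul_X, ← polyMul_mul, mul_comm, polyMul_mul, polyMul_X, backShift_shift]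
      rw [hstep, hf, map_add, smul_add, add_sub_add_comm, hq, hB, mul_comm, polyMul_mul,
        polyMul_X_sub_C, ← map_smul, ← map_sub, map_smul shift, smul_smul, mul_neg, conj_mul_circle]
      congr 2
      module

theorem mem_rangeSpace_iff_of_mem_classA {a : ℂ[X]} (ha : a ∈ classA) (g : 𝔻 → ℂ) :
    g ∈ rangeSpace a ↔ ∃ (h : Seq2) (p : ℂ[X]), g = ev (polyMul a h + polySeq p) := by
  rw [mem_rangeSpace_iff]
  constructor
  · rintro ⟨f, rfl⟩
    obtain ⟨h, p, hp⟩ : aeval backShift (a.map (starRingEnd ℂ)) f ∈ polyRange a :=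
      range_aeval_backShift ha ▸ ⟨f, rfl⟩
    exact ⟨h, p, by rw [hp]⟩
  · rintro ⟨h, p, rfl⟩
    have : polyMul a h + polySeq p ∈ polyRange a := ⟨h, p, rfl⟩
    rw [← range_aeval_backShift ha] at this
    obtain ⟨f, hf⟩ := this
    exact ⟨f, by rw [hf]⟩

/-! ### Polynomials in `a H²`, and density of `a H²` -/

theorem exists_eq_polySeq {u : Seq2} {N : ℕ} (hu : ∀ n, N ≤ n → u n = 0) :
    ∃ q : ℂ[X], u = polySeq q := by
  refine ⟨∑ n ∈ Finset.range N, monomial n (u n), ?_⟩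
  ext n
  rw [polySeq_apply, finsetSum_coeff]
  simp only [coeff_monomial, Finset.sum_ite_eq', Finset.mem_range]
  split_ifs with hn
  · rfl
  · exact hu n (not_lt.mp hn)

/-- If `(z - ζ) u` is a polynomial then so is `u`, since eventually `|û(n)|` is constant. -/
theorem exists_polySeq_of_polyMul_X_sub_C (ζ : Circle) {u : Seq2} {p : ℂ[X]}
    (h : polyMul (X - C (ζ : ℂ)) u = polySeq p) : ∃ q : ℂ[X], u = polySeq q := by
  rw [polyMul_X_sub_C] at h
  have hstep : ∀ n, p.natDegree ≤ n → ‖u (n + 1)‖ = ‖u n‖ := by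
    intro n hn
    have := congrArg (fun f : Seq2 => f (n + 1)) h
    simp only [lp.coeFn_sub, Pi.sub_apply, shift_apply_succ, lp.coeFn_smul, Pi.smul_apply,
      polySeq_apply, smul_eq_mul, coeff_eq_zero_of_natDegree_lt (Nat.lt_succ_of_le hn)] at this
    rw [sub_eq_zero] at this
    simpa [Circle.norm_coe] using (congrArg norm this).symm
  have hconst : ∀ n, p.natDegree ≤ n → ∀ k, ‖u (n + k)‖ = ‖u n‖ := by
    intro n hn k
    induction k with
    | zero => rfl
    | succ k ih => rw [← add_assoc, hstep _ (by omega), ih]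
  have hlim := (summable_sq u).tendsto_atTop_zero
  refine exists_eq_polySeq (N := p.natDegree) fun n hn => ?_
  have h1 : Tendsto (fun k => ‖u (n + k)‖ ^ 2) atTop (𝓝 0) := by
    simpa only [add_comm n, Function.comp_def] using (tendsto_add_atTop_iff_nat n).mpr hlim
  simp only [hconst n hn] at h1
  simpa using tendsto_nhds_unique tendsto_const_nhds h1

theorem exists_polySeq_of_polyMul {a : ℂ[X]} (ha : a ∈ classA) {u : Seq2} {p : ℂ[X]}
    (h : polyMul a u = polySeq p) : ∃ q : ℂ[X], u = polySeq q := by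
  induction ha using classA_induction generalizing p with
  | one => exact ⟨p, by simpa using h⟩
  | mul ζ b _ ih =>
    rw [polyMul_mul] at h
    obtain ⟨q, hq⟩ := exists_polySeq_of_polyMul_X_sub_C ζ h
    exact ih hq

theorem denseRange_polyMul_X_sub_C (ζ : Circle) : DenseRange (polyMul (X - C (ζ : ℂ))) := by
  have h : (LinearMap.range (polyMul (X - C (ζ : ℂ))).toLinearMap).topologicalClosure = ⊤ := by
    rw [Submodule.topologicalClosure_eq_top_iff, Submodule.eq_bot_iff]
    intro v hv
    rw [Submodule.mem_orthogonal] at hv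
    -- Orthogonality to `(z - ζ) zⁿ` makes `|v̂(n)|` constant.
    have hrec : ∀ n, ‖v (n + 1)‖ = ‖v n‖ := by
      intro n
      have h1 := hv _ ⟨lp.single 2 n 1, rfl⟩
      have h2 : shift (lp.single 2 n 1) = lp.single 2 (n + 1) 1 := by
        ext m
        cases m with
        | zero => simp
        | succ m => by_cases hm : m = n <;> simp [lp.single_apply, hm]
      rw [ContinuousLinearMap.coe_coe, polyMul_X_sub_C, h2, inner_sub_left, inner_smul_left,
        lp.inner_single_left, lp.inner_single_left, sub_eq_zero] at h1
      simpa [Circle.norm_coe] using congrArg norm h1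
    have hconst : ∀ n, ‖v n‖ = ‖v 0‖ := by
      intro n
      induction n with
      | zero => rfl
      | succ n ih => rw [hrec, ih]
    have hlim := (summable_sq v).tendsto_atTop_zero
    simp only [hconst] at hlim
    have h0 : ‖v 0‖ ^ 2 = 0 := tendsto_nhds_unique tendsto_const_nhds hlim
    ext n
    rw [lp.coeFn_zero, Pi.zero_apply, ← norm_eq_zero, hconst n]
    exact pow_eq_zero_iff two_ne_zero |>.mp h0
  intro x
  have hx : x ∈ (LinearMap.range (polyMul (X - C (ζ : ℂ))).toLinearMap).topologicalClosure :=
    h ▸ Submodule.mem_top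
  exact hx

/-- `a H²` is dense in `H²`: polynomials of class `𝒜` are outer. -/
theorem denseRange_polyMul {a : ℂ[X]} (ha : a ∈ classA) : DenseRange (polyMul a) := by
  induction ha using classA_induction with
  | one =>
    intro x
    exact subset_closure ⟨x, by simp⟩
  | mul ζ b _ ih =>
    have : (polyMul ((X - C (ζ : ℂ)) * b) : Seq2 → Seq2) = polyMul (X - C (ζ : ℂ)) ∘ polyMul b :=
      funext fun f => polyMul_mul _ _ f
    rw [this]
    exact (denseRange_polyMul_X_sub_C ζ).comp ih (ContinuousLinearMap.continuous _)

/-! ### Multipliers of `H²` into `a H² + ℂ[z]` -/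

/-- The sum of `a H²` and the polynomials of degree less than `deg a` is direct. -/
theorem polyMul_add_injective {a : ℂ[X]} (ha : a ∈ classA) {u v w x : Seq2}
    (hw : ∀ n, a.natDegree ≤ n → w n = 0) (hx : ∀ n, a.natDegree ≤ n → x n = 0)
    (h : polyMul a u + w = polyMul a v + x) : u = v ∧ w = x := by
  have hxw : ∀ n, a.natDegree ≤ n → (x - w) n = 0 := by
    intro n hn
    rw [lp.coeFn_sub, Pi.sub_apply, hw n hn, hx n hn, sub_zero]
  have huv : polyMul a (u - v) = x - w := by
    rw [map_sub, sub_eq_sub_iff_add_eq_add, h, add_comm]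
  obtain ⟨q, hq⟩ := exists_eq_polySeq hxw
  obtain ⟨r, hr⟩ := exists_polySeq_of_polyMul ha (huv.trans hq)
  have hr0 : r = 0 := by
    rw [← leadingCoeff_eq_zero]
    have h1 := hxw (a.natDegree + r.natDegree) (Nat.le_add_right _ _)
    rwa [← huv, hr, polyMul_polySeq, polySeq_apply, coeff_mul_degree_add_degree,
      (monic_of_mem_classA ha).leadingCoeff, one_mul] at h1
  have h0 : u - v = 0 := by rw [hr, hr0, map_zero]
  rw [h0, map_zero] at huv
  exact ⟨sub_eq_zero.mp h0, (sub_eq_zero.mp huv.symm).symm⟩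

/-- Every element of `a H² + ℂ[z]` has a representation with a polynomial of degree less than
`deg a`. -/
theorem exists_polyMul_add_of_polySeq {a : ℂ[X]} (ha : a ∈ classA) (u : Seq2) (p : ℂ[X]) :
    ∃ v w : Seq2, (∀ n, a.natDegree ≤ n → w n = 0) ∧
      polyMul a u + polySeq p = polyMul a v + w := by
  have hm := monic_of_mem_classA ha
  refine ⟨u + polySeq (p /ₘ a), polySeq (p %ₘ a), fun n hn => ?_, ?_⟩
  · rw [polySeq_apply]
    refine coeff_eq_zero_of_degree_lt ((degree_modByMonic_lt p hm).trans_le ?_)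
    exact degree_le_natDegree.trans (by exact_mod_cast hn)
  · conv_lhs => rw [← modByMonic_add_div p a]
    rw [map_add, map_add, polyMul_polySeq]
    abel

theorem le_of_forall_pow_le {x y K : ℝ} (hy : 0 ≤ y) (h : ∀ n : ℕ, x ^ n ≤ K * y ^ n) :
    x ≤ y := by
  by_contra! hxy
  have hx : 0 < x := hy.trans_lt hxy
  have hlim : Tendsto (fun n : ℕ => K * (y / x) ^ n) atTop (𝓝 (K * 0)) :=
    (tendsto_pow_atTop_nhds_zero_of_lt_one (by positivity) ((div_lt_one hx).mpr hxy)).const_mul K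
  have h1 : (1 : ℝ) ≤ K * 0 := by
    refine ge_of_tendsto' hlim fun n => ?_
    rw [div_pow, ← mul_div_assoc, one_le_div (by positivity)]
    exact h n
  norm_num at h1

/-- A function which multiplies `H²` into `H²` is bounded by the norm of the multiplication
operator `M`, because `b(z)ⁿ` is the value at `z` of `Mⁿ 1`. -/
theorem norm_ev_le_of_multiplier {b : 𝔻 → ℂ} (M : Seq2 →L[ℂ] Seq2)
    (hM : ∀ h, ev (M h) = b * ev h) (z : 𝔻) : ‖b z‖ ≤ ‖M‖ := by
  have hpow : ∀ n : ℕ, ev ((M ^ n) oneSeq) z = b z ^ n := by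
    intro n
    induction n with
    | zero => simp [ev_oneSeq]
    | succ n ih => rw [pow_succ', mul_apply_eq_comp, hM, Pi.mul_apply, ih, pow_succ']
  refine le_of_forall_pow_le (K := (1 - ‖(z : ℂ)‖)⁻¹ * ‖oneSeq‖) (norm_nonneg M) fun n => ?_
  rw [← norm_pow, ← hpow, mul_assoc]
  refine (norm_ev_le _ z).trans ?_
  have hz : 0 ≤ (1 - ‖(z : ℂ)‖)⁻¹ := inv_nonneg.mpr (sub_nonneg.mpr z.norm_lt_one.le)
  gcongr
  rw [mul_comm]
  refine ((M ^ n).le_opNorm _).trans ?_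
  gcongr
  induction n with
  | zero =>
    rw [pow_zero, pow_zero]
    exact ContinuousLinearMap.norm_id_le
  | succ n ih =>
    rw [pow_succ, pow_succ]
    exact (ContinuousLinearMap.opNorm_comp_le _ _).trans (by gcongr)

/-- If `Φ H² ⊆ a H² + ℂ[z]` then `Φ ∈ a H^∞`. Write `Φ h = a u + w` with `w` a polynomial of degree
less than `deg a`. By the closed graph theorem `u` and `w` depend continuously on `h`. Since
`Φ (a f) = a (Φ f)`, the polynomial `w` vanishes for `h` in the dense subspace `a H²`, hence always,
and `Φ / a` is a multiplier of `H²`. -/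
theorem exists_bounded_of_mul_mem {a : ℂ[X]} (ha : a ∈ classA) {Φ : 𝔻 → ℂ}
    (hΦ : ∀ h : Seq2, ∃ (u : Seq2) (p : ℂ[X]), Φ * ev h = ev (polyMul a u + polySeq p)) :
    ∃ b : Seq2, (∃ C : ℝ, ∀ z, ‖ev b z‖ ≤ C) ∧ ∀ z : 𝔻, Φ z = a.eval (z : ℂ) * ev b z := by
  have hex : ∀ h : Seq2, ∃ t : Seq2 × Seq2, (∀ n, a.natDegree ≤ n → t.2 n = 0) ∧
      Φ * ev h = ev (polyMul a t.1 + t.2) := by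
    intro h
    obtain ⟨u, p, hup⟩ := hΦ h
    obtain ⟨v, w, hw, hvw⟩ := exists_polyMul_add_of_polySeq ha u p
    exact ⟨(v, w), hw, by rw [hup, hvw]⟩
  choose t ht₀ ht using hex
  have huniq : ∀ h v w, (∀ n, a.natDegree ≤ n → w n = 0) → Φ * ev h = ev (polyMul a v + w) →
      (v, w) = t h := by
    intro h v w hw hvw
    obtain ⟨h1, h2⟩ := polyMul_add_injective ha hw (ht₀ h) (ev_injective (hvw.symm.trans (ht h)))
    exact Prod.ext h1 h2
  let T : Seq2 →ₗ[ℂ] Seq2 × Seq2 :=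
    { toFun := t
      map_add' := by
        intro f g
        refine (huniq _ (t f + t g).1 (t f + t g).2 (fun n hn => ?_) ?_).symm
        · rw [Prod.snd_add, lp.coeFn_add, Pi.add_apply, ht₀ f n hn, ht₀ g n hn, add_zero]
        · rw [map_add, mul_add, ht, ht, ← map_add, Prod.fst_add, Prod.snd_add, map_add (polyMul a),
            add_add_add_comm]
      map_smul' := by
        intro c f
        refine (huniq _ (c • t f).1 (c • t f).2 (fun n hn => ?_) ?_).symm
        · rw [Prod.smul_snd, lp.coeFn_smul, Pi.smul_apply, ht₀ f n hn, smul_zero]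
        · rw [map_smul, mul_smul_comm, ht, ← map_smul, Prod.smul_fst, Prod.smul_snd,
            map_smul (polyMul a), smul_add] }
  have hT : Continuous T := by
    refine T.continuous_of_seq_closed_graph fun s x y hs hTs => ?_
    have h1 : Tendsto (fun n => (t (s n)).1) atTop (𝓝 y.1) := (continuous_fst.tendsto y).comp hTs
    have h2 : Tendsto (fun n => (t (s n)).2) atTop (𝓝 y.2) := (continuous_snd.tendsto y).comp hTs
    refine huniq x y.1 y.2 (fun n hn => ?_) ?_
    · have h3 : Tendsto (fun m => (t (s m)).2 n) atTop (𝓝 (y.2 n)) :=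
        ((lp.lipschitzWith_one_eval (E := fun _ : ℕ => ℂ) 2 n).continuous.tendsto _).comp h2
      simp only [fun m => ht₀ (s m) n hn] at h3
      exact tendsto_nhds_unique h3 tendsto_const_nhds
    · ext z
      have h3 : Tendsto (fun n => Φ z * ev (s n) z) atTop (𝓝 (Φ z * ev x z)) :=
        (((continuous_ev_apply z).tendsto x).comp hs).const_mul _
      have h4 : Tendsto (fun n => ev (polyMul a (t (s n)).1 + (t (s n)).2) z) atTop
          (𝓝 (ev (polyMul a y.1 + y.2) z)) :=
        ((continuous_ev_apply z).tendsto _).comp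
          ((((polyMul a).continuous.tendsto _).comp h1).add h2)
      simp only [← ht, Pi.mul_apply] at h4
      exact tendsto_nhds_unique h3 h4
  have hsnd : ∀ h, (t h).2 = 0 := by
    refine fun h => congrFun ((denseRange_polyMul ha).equalizer (continuous_snd.comp hT)
      continuous_const (funext fun f => ?_)) h
    refine (congrArg Prod.snd (huniq (polyMul a f) (polyMul a (t f).1 + (t f).2) 0
      (fun _ _ => rfl) ?_)).symm
    ext z
    rw [add_zero, ev_polyMul, ← ht, Pi.mul_apply, Pi.mul_apply, ev_polyMul]
    ring
  let M : Seq2 →L[ℂ] Seq2 := ⟨LinearMap.fst ℂ Seq2 Seq2 ∘ₗ T, continuous_fst.comp hT⟩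
  have hM : ∀ h z, Φ z * ev h z = a.eval (z : ℂ) * ev (M h) z := by
    intro h z
    have := congrFun (ht h) z
    rwa [hsnd, add_zero, ev_polyMul] at this
  have hone : ∀ z, Φ z = a.eval (z : ℂ) * ev (M oneSeq) z := by
    intro z
    rw [← hM, ev_oneSeq, mul_one]
  refine ⟨M oneSeq, ⟨‖M‖, norm_ev_le_of_multiplier M fun h => ?_⟩, hone⟩
  ext z
  have h1 := hM h z
  rw [hone z, mul_assoc] at h1
  exact (mul_left_cancel₀ (eval_ne_zero_of_mem_classA ha z) h1).symm

/-! ### The multipliers -/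

theorem mul_mem_multipliers {a₁ K : ℂ[X]} (ha₁ : a₁ ∈ classA) (ha₂ : a₁ * K ∈ classA)
    {ψ : 𝔻 → ℂ} (hψ : ψ ∈ rangeSpace a₁) (hψb : ψ ∈ Hinf) :
    (fun z : 𝔻 => K.eval (z : ℂ)) * ψ ∈ multipliers a₁ (a₁ * K) := by
  obtain ⟨g, q, hgq⟩ := (mem_rangeSpace_iff_of_mem_classA ha₁ ψ).mp hψ
  refine ⟨?_, fun f hf => ?_⟩
  · convert ev_mem_analyticFunctions (polyMul K (polyMul a₁ g + polySeq q)) using 1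
    ext z
    rw [ev_polyMul, Pi.mul_apply, hgq]
  · obtain ⟨h, p, rfl⟩ := (mem_rangeSpace_iff_of_mem_classA ha₁ f).mp hf
    rw [mem_rangeSpace_iff_of_mem_classA ha₂]
    obtain ⟨u, hu⟩ := exists_ev_eq_mul hψb h
    -- `K ψ (a₁ h + p) = a₁ K (ψ h) + K (a₁ g + q) p`
    refine ⟨u + polyMul p g, K * q * p, ?_⟩
    ext z
    have hz := congrFun hgq z
    simp only [map_add, Pi.add_apply, ev_polyMul, ev_polySeq, eval_mul, hu, Pi.mul_apply]
      at hz ⊢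
    linear_combination K.eval (z : ℂ) * p.eval (z : ℂ) * hz

theorem exists_eq_mul_of_mem_multipliers {a₁ K : ℂ[X]} (ha₁ : a₁ ∈ classA) (hK : K ∈ classA)
    (ha₂ : a₁ * K ∈ classA) {φ : 𝔻 → ℂ} (hφ : φ ∈ multipliers a₁ (a₁ * K)) :
    ∃ ψ ∈ rangeSpace a₁ ∩ Hinf, (fun z : 𝔻 => K.eval (z : ℂ)) * ψ = φ := by
  have hmem : ∀ (h : Seq2) (p : ℂ[X]), ∃ (u : Seq2) (q : ℂ[X]),
      φ * ev (polyMul a₁ h + polySeq p) = ev (polyMul (a₁ * K) u + polySeq q) := fun h p =>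
    (mem_rangeSpace_iff_of_mem_classA ha₂ _).mp
      (hφ.2 _ ((mem_rangeSpace_iff_of_mem_classA ha₁ _).mpr ⟨h, p, rfl⟩))
  obtain ⟨b, hb, hφb⟩ := exists_bounded_of_mul_mem ha₂
    (Φ := φ * fun z : 𝔻 => a₁.eval (z : ℂ)) fun h => by
      obtain ⟨u, q, huq⟩ := hmem h 0
      refine ⟨u, q, ?_⟩
      rw [← huq]
      ext z
      simp only [map_zero, add_zero, Pi.mul_apply, ev_polyMul, mul_assoc]
  have hφK : ∀ z : 𝔻, K.eval (z : ℂ) * ev b z = φ z := by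
    intro z
    refine mul_left_cancel₀ (eval_ne_zero_of_mem_classA ha₁ z) ?_
    have := hφb z
    rw [Pi.mul_apply, eval_mul] at this
    linear_combination -this
  refine ⟨ev b, ⟨?_, ev_mem_analyticFunctions b, hb⟩, funext hφK⟩
  -- As `1 ∈ 𝓜(ā₁)`, also `K b = φ = a₁ K g + q`, so that `K (b - a₁ g)` is a polynomial.
  obtain ⟨g, q, hgq⟩ := hmem 0 1
  have hpoly : polyMul K (b - polyMul a₁ g) = polySeq q := by
    apply ev_injective
    ext z
    have hz := congrFun hgq z
    simp only [map_zero, zero_add, Pi.mul_apply, map_add, Pi.add_apply, ev_polySeq, ev_polyMul,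
      eval_one, eval_mul, mul_one] at hz
    rw [ev_polyMul, map_sub, Pi.sub_apply, ev_polyMul, ev_polySeq]
    linear_combination hφK z + hz
  obtain ⟨r, hr⟩ := exists_polySeq_of_polyMul hK hpoly
  rw [mem_rangeSpace_iff_of_mem_classA ha₁]
  exact ⟨g, r, by rw [← hr, add_sub_cancel]⟩

end ToeplitzRange

end

theorem theorem1p2 (a₁ a₂ : ℂ[X]) (ha₁ : a₁ ∈ ToeplitzRange.classA)
    (ha₂ : a₂ ∈ ToeplitzRange.classA) (k : 𝔻 → ℂ)
    (hk : k = fun z : 𝔻 => a₂.eval (z : ℂ) / a₁.eval (z : ℂ))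
    (hk_bdd : k ∈ ToeplitzRange.Hinf) :
    ToeplitzRange.multipliers a₁ a₂ =
      (fun ψ : 𝔻 → ℂ => k * ψ) '' (ToeplitzRange.rangeSpace a₁ ∩ ToeplitzRange.Hinf) := by
  have ha₁z := ToeplitzRange.eval_ne_zero_of_mem_classA ha₁
  obtain ⟨-, M, hM⟩ := hk_bdd
  obtain ⟨K, hK, rfl⟩ := ToeplitzRange.exists_eq_mul_of_norm_le ha₁ ha₂ (M := M) fun z => by
    have := hM z
    rwa [hk, norm_div, div_le_iff₀ (norm_pos_iff.mpr (ha₁z z))] at this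
  obtain rfl : k = fun z : 𝔻 => K.eval (z : ℂ) := by
    rw [hk]
    ext z
    rw [eval_mul, mul_div_cancel_left₀ _ (ha₁z z)]
  ext φ
  constructor
  · exact fun hφ => ToeplitzRange.exists_eq_mul_of_mem_multipliers ha₁ hK ha₂ hφ
  · rintro ⟨ψ, ⟨hψ, hψb⟩, rfl⟩
    exact ToeplitzRange.mul_mem_multipliers ha₁ ha₂ hψ hψb
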